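/- Let $d\ge 0$ and let $\Omega\subset\mathbb{R}^d$ be compact. Let $f:\Omega\times\mathbb{R}\times\mathbb{R}^d\times\mathbb{R}\to[0,+\infty]$ be an infinitesimal cost: for every $x\in\Omega$ the function $f(x,\cdot,\cdot,\cdot)$ is convex, positively $1$-homogeneous and lower semicontinuous, $f(x,\rho,0,0)=0$ for $\rho\ge 0$, $f(x,\rho,\omega,\zeta)>0$ whenever $\omega\neq 0$ or $\zeta\ne 0$, and $f(x,\rho,\omega,\zeta)=+\infty$ whenever $\rho<0$. Let $$B(x)=\{(\alpha,\beta,\gamma)\in\mathbb{R}\times\mathbb{R}^d\times\mathbb{R}:\ \alpha\rho+\beta\cdot\omega+\gamma\zeta\le f(x,\rho,\omega,\zeta)\ \text{ for all } (\rho,\omega,\zeta)\}$$ be the polar set of $f(x,\cdot,\cdot,\cdot)$, and assume that the set-valued map $x\mapsto B(x)$ is lower semicontinuous, in the sense that $\{(x,y): x\in\Omega,\ y\in\operatorname{int}B(x)\}$ is open in $\Omega\times\mathbb{R}^{d+2}$. Write $\mathcal{M}(X)$ for the finite signed Borel measures on $X$ and $\mathcal{M}_+(X)$ for the nonnegative ones,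 and let $C^1([0,1]\times\Omega)$ denote the restrictions to $[0,1]\times\Omega$ of $C^1$ functions on $\mathbb{R}\times\mathbb{R}^d$, together with the restrictions of their first derivatives. For $\rho_0,\rho_1\in\mathcal{M}_+(\Omega)$ let $\mathcal{CE}_0^1(\rho_0,\rho_1)$ be the set of triplets $(\rho,\omega,\zeta)\in\mathcal{M}([0,1]\times\Omega)\times\mathcal{M}([0,1]\times\Omega)^d\times\mathcal{M}([0,1]\times\Omega)$ such that, for all $\varphi\in C^1([0,1]\times\Omega)$, $$\int\partial_t\varphi\,d\rho+\int\nabla\varphi\cdot d\omega+\int\varphi\,d\zeta=\int_\Omega\varphi(1,\cdot)\,d\rho_1-\int_\Omega\varphi(0,\cdot)\,d\rho_0 .$$ Let $$J_D(\rho,\omega,\zeta)=\int_{[0,1]\times\Omega}f\Big(x,\frac{d\rho}{d\lambda},\frac{d\omega}{d\lambda},\frac{d\zeta}{d\lambda}\Big)\,d\lambda(t,x),$$ where $\lambda\in\mathcal{M}_+([0,1]\times\Omega)$ is any measure with $(\rho,\omega,\zeta)\ll\lambda$ (by homogeneity the value does not depend on $\lambda$), and let $C_D(\rho_0,\rho_1)=\inf\{J_D(\rho,\omega,\zeta):(\rho,\omega,\zeta)\in\mathcal{CE}_0^1(\rho_0,\rho_1)\}\in[0,+\infty]$.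 Then for all $\rho_0,\rho_1\in\mathcal{M}_+(\Omega)$ the infimum defining $C_D(\rho_0,\rho_1)$ is attained (its value may be $+\infty$), and $$C_D(\rho_0,\rho_1)=\sup_{\varphi\in K}\Big(\int_\Omega\varphi(1,\cdot)\,d\rho_1-\int_\Omega\varphi(0,\cdot)\,d\rho_0\Big),$$ where $K=\{\varphi\in C^1([0,1]\times\Omega):(\partial_t\varphi,\nabla\varphi,\varphi)(t,x)\in B(x)\ \text{ for all }(t,x)\in[0,1]\times\Omega\}$. -/

import Mathlib

open MeasureTheory Set
open scoped ENNReal NNReal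

noncomputable section

namespace DynamicOT

/-- The ambient space `ℝ^d` with its Euclidean structure. -/
abbrev Space (d : ℕ) : Type := EuclideanSpace ℝ (Fin d)

/-- The space `ℝ × ℝ^d × ℝ` of values `(ρ, ω, ζ)`; also the space of dual values
`(∂ₜφ, ∇φ, φ)`. -/
abbrev Val (d : ℕ) : Type := ℝ × Space d × ℝ

variable {d : ℕ} {Ω : Set (Space d)}

/-- Infinitesimal costs `f : Ω × ℝ × ℝ^d × ℝ → [0, +∞]`: for every `x ∈ Ω`, the function
`f x` is convex, positively 1-homogeneous, lower semicontinuous, vanishes at `(ρ, 0, 0)` for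
`ρ ≥ 0`, is positive as soon as `ω ≠ 0` or `ζ ≠ 0`, and is `+∞` for `ρ < 0`. -/
structure IsInfinitesimalCost (f : Ω → Val d → ℝ≥0∞) : Prop where
  convexOn : ∀ x, ConvexOn ℝ≥0 univ (f x)
  homogeneous : ∀ x, ∀ t : ℝ, 0 < t → ∀ z : Val d, f x (t • z) = ENNReal.ofReal t * f x z
  lowerSemicontinuous : ∀ x, LowerSemicontinuous (f x)
  eq_zero : ∀ x, ∀ ρ : ℝ, 0 ≤ ρ → f x (ρ, 0, 0) = 0
  pos : ∀ x, ∀ (ρ : ℝ) (ω : Space d) (ζ : ℝ), ω ≠ 0 ∨ ζ ≠ 0 → 0 < f x (ρ, ω, ζ)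
  eq_top : ∀ x, ∀ (ρ : ℝ) (ω : Space d) (ζ : ℝ), ρ < 0 → f x (ρ, ω, ζ) = ∞

/-- The polar set of a positively 1-homogeneous convex function `g`: the set of all
`y = (α, β, γ)` with `α ρ + β · ω + γ ζ ≤ g (ρ, ω, ζ)` for all `(ρ, ω, ζ)`. -/
def polarSet (g : Val d → ℝ≥0∞) : Set (Val d) :=
  {y | ∀ z : Val d,
    ((y.1 * z.1 + inner ℝ y.2.1 z.2.1 + y.2.2 * z.2.2 : ℝ) : EReal) ≤ (g z : EReal)}

/-- Lower semicontinuity of a (nonempty convex valued) multifunction `Q`: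
the set `{(x, y) : y ∈ int Q(x)}` is open. -/
def IsLSCMultifunction {X V : Type*} [TopologicalSpace X] [TopologicalSpace V]
    (Q : X → Set V) : Prop :=
  IsOpen {p : X × V | p.2 ∈ interior (Q p.1)}

/-- The space-time domain `[a, b] × Ω`. -/
abbrev Cyl (a b : ℝ) (Ω : Set (Space d)) : Type := Icc a b × Ω

/-- Triplets `(ρ, ω, ζ)` in `M([a,b] × Ω) × M([a,b] × Ω)^d × M([a,b] × Ω)`, where `M` is the
space of finite signed Borel measures. -/
@[ext]
structure MeasureTriple (a b : ℝ) (Ω : Set (Space d)) where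
  ρ : SignedMeasure (Cyl a b Ω)
  ω : Fin d → SignedMeasure (Cyl a b Ω)
  ζ : SignedMeasure (Cyl a b Ω)

/-- The time derivative `∂ₜφ(t, x)`. -/
def timeDeriv (φ : ℝ × Space d → ℝ) (t : ℝ) (x : Space d) : ℝ :=
  deriv (fun s => φ (s, x)) t

/-- The spatial gradient `∇φ(t, x)`. -/
def spaceGrad (φ : ℝ × Space d → ℝ) (t : ℝ) (x : Space d) : Space d :=
  gradient (fun y => φ (t, y)) x

/-- The set `CE_a^b(ρ_a, ρ_b)` of weak solutions on `[a, b] × Ω` of the continuity equation with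
source `∂ₜρ + ∇·ω = ζ`, with homogeneous Neumann boundary conditions, interpolating between `ρ_a`
and `ρ_b`. The test functions are the (restrictions to `[a, b] × Ω` of) functions of class `C¹`. -/
def ContinuityEq (a b : ℝ) (Ω : Set (Space d)) (ρa ρb : Measure Ω) :
    Set (MeasureTriple a b Ω) :=
  {μ | ∀ φ : ℝ × Space d → ℝ, ContDiff ℝ 1 φ →
    (∫ᵛ p, timeDeriv φ p.1 p.2 ∂<•μ.ρ)
      + ∑ i, (∫ᵛ p, spaceGrad φ p.1 p.2 i ∂<•(μ.ω i))
      + (∫ᵛ p, φ (p.1, p.2) ∂<•μ.ζ)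
    = (∫ x, φ (b, x) ∂ρb) - ∫ x, φ (a, x) ∂ρa}

namespace MeasureTriple

variable {a b : ℝ}

/-- The density of `(ρ, ω, ζ)` with respect to a positive measure `l`. -/
def density (μ : MeasureTriple a b Ω) (l : Measure (Cyl a b Ω)) (p : Cyl a b Ω) : Val d :=
  (μ.ρ.rnDeriv l p, WithLp.toLp 2 (fun i => (μ.ω i).rnDeriv l p), μ.ζ.rnDeriv l p)

/-- `(ρ, ω, ζ) ≪ l`. -/
def AbsCont (μ : MeasureTriple a b Ω) (l : Measure (Cyl a b Ω)) : Prop :=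
  μ.ρ.totalVariation ≪ l ∧ (∀ i, (μ.ω i).totalVariation ≪ l) ∧ μ.ζ.totalVariation ≪ l

/-- A finite positive measure dominating `(ρ, ω, ζ)`: the sum of the total variations. -/
def dominating (μ : MeasureTriple a b Ω) : Measure (Cyl a b Ω) :=
  μ.ρ.totalVariation + ∑ i, (μ.ω i).totalVariation + μ.ζ.totalVariation

end MeasureTriple

/-- `∫∫ f(x, dρ/dl, dω/dl, dζ/dl) dl`. -/
def actionWrt {a b : ℝ} (f : Ω → Val d → ℝ≥0∞) (μ : MeasureTriple a b Ω)
    (l : Measure (Cyl a b Ω)) : ℝ≥0∞ :=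
  ∫⁻ p, f p.2 (μ.density l p) ∂l

/-- The functional `J_D`. The integral is taken with respect to one particular dominating
measure; by `actionWrt_eq_action` every other one gives the same value. -/
def action (f : Ω → Val d → ℝ≥0∞) (μ : MeasureTriple 0 1 Ω) : ℝ≥0∞ :=
  actionWrt f μ μ.dominating

/-- The value `C_D(ρ₀, ρ₁)` of the dynamic problem. -/
def dynamicCost (f : Ω → Val d → ℝ≥0∞) (ρ₀ ρ₁ : Measure Ω) : ℝ≥0∞ :=
  ⨅ μ ∈ ContinuityEq 0 1 Ω ρ₀ ρ₁, action f μ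

/-- The set `K` of dual competitors: `C¹` functions `φ` such that
`(∂ₜφ, ∇φ, φ)(t, x) ∈ B(x)` for all `(t, x) ∈ [0, 1] × Ω`, with `B(x)` the polar set of `f x`. -/
def dualFeasible (f : Ω → Val d → ℝ≥0∞) : Set (ℝ × Space d → ℝ) :=
  {φ | ContDiff ℝ 1 φ ∧ ∀ t ∈ Icc (0 : ℝ) 1, ∀ x : Ω,
    (timeDeriv φ t x, spaceGrad φ t x, φ (t, x)) ∈ polarSet (f x)}

/-! ### Well-definedness of the action -/

lemma rnDeriv_chain {X : Type*} [MeasurableSpace X] (s : SignedMeasure X) (k l : Measure X)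
    [IsFiniteMeasure k] [IsFiniteMeasure l] (hsk : s.totalVariation ≪ k) :
    ∀ᵐ p ∂l, s.rnDeriv l p = (k.rnDeriv l p).toReal * s.rnDeriv k p := by
  have hp : s.toJordanDecomposition.posPart ≪ k := by
    refine Measure.AbsolutelyContinuous.trans ?_ hsk
    exact (Measure.le_add_right le_rfl).absolutelyContinuous
  have hn : s.toJordanDecomposition.negPart ≪ k := by
    refine Measure.AbsolutelyContinuous.trans ?_ hsk
    exact (Measure.le_add_left le_rfl).absolutelyContinuous
  filter_upwards [Measure.rnDeriv_mul_rnDeriv (κ := l) hp,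
    Measure.rnDeriv_mul_rnDeriv (κ := l) hn] with p h1 h2
  rw [SignedMeasure.rnDeriv_def, SignedMeasure.rnDeriv_def]
  simp only [Pi.mul_apply] at h1 h2
  simp only [← h1, ← h2, ENNReal.toReal_mul]
  ring

instance instFiniteDominating {a b : ℝ} (μ : MeasureTriple a b Ω) :
    IsFiniteMeasure μ.dominating := by
  have h : ∀ s : SignedMeasure (Cyl a b Ω), IsFiniteMeasure s.totalVariation := fun s => by
    unfold SignedMeasure.totalVariation; infer_instance
  unfold MeasureTriple.dominating
  have := h μ.ρ
  have := h μ.ζ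
  have := fun i => h (μ.ω i)
  infer_instance

lemma actionWrt_eq_action {f : Ω → Val d → ℝ≥0∞} (hf : IsInfinitesimalCost f)
    (μ : MeasureTriple 0 1 Ω) (l : Measure (Cyl 0 1 Ω)) [IsFiniteMeasure l]
    (hl : μ.AbsCont l) : actionWrt f μ l = action f μ := by
  set k := μ.dominating with hk
  have hkl : k ≪ l := by
    intro s hs
    simp [hk, MeasureTriple.dominating, hl.1 hs, hl.2.2 hs, fun i => hl.2.1 i hs]
  have h1 : μ.ρ.totalVariation ≪ k := by
    refine Measure.absolutelyContinuous_of_le ?_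
    rw [hk, MeasureTriple.dominating, add_assoc]
    exact Measure.le_add_right le_rfl
  have h3 : μ.ζ.totalVariation ≪ k := by
    refine Measure.absolutelyContinuous_of_le ?_
    rw [hk, MeasureTriple.dominating]
    exact Measure.le_add_left le_rfl
  have h2 : ∀ i, (μ.ω i).totalVariation ≪ k := by
    intro i s hs
    simp only [hk, MeasureTriple.dominating, Measure.coe_add, Pi.add_apply, add_eq_zero,
      Measure.coe_finsetSum, Finset.sum_apply, Finset.sum_eq_zero_iff] at hs
    exact hs.1.2 i (Finset.mem_univ i)
  have e : action f μ = ∫⁻ p, k.rnDeriv l p * f p.2 (μ.density k p) ∂l := by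
    unfold action actionWrt
    rw [← hk]
    conv_lhs => rw [← Measure.withDensity_rnDeriv_eq k l hkl]
    rw [lintegral_withDensity_eq_lintegral_mul_non_measurable _ (Measure.measurable_rnDeriv k l)
      (Measure.rnDeriv_lt_top k l), Measure.withDensity_rnDeriv_eq k l hkl]
    rfl
  rw [e]
  unfold actionWrt
  apply lintegral_congr_ae
  filter_upwards [rnDeriv_chain μ.ρ k l h1, rnDeriv_chain μ.ζ k l h3,
    ae_all_iff.2 fun i => rnDeriv_chain (μ.ω i) k l (h2 i),
    Measure.rnDeriv_lt_top k l] with p q1 q3 q2 q4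
  have q : μ.density l p = (k.rnDeriv l p).toReal • μ.density k p := by
    simp only [MeasureTriple.density, q1, q3, q2]
    rfl
  rw [q]
  rcases (ENNReal.toReal_nonneg (a := k.rnDeriv l p)).eq_or_lt with h | h
  · have h' : k.rnDeriv l p = 0 := by
      rcases (ENNReal.toReal_eq_zero_iff _).1 h.symm with h | h
      · exact h
      · exact absurd h q4.ne
    have := hf.eq_zero p.2 0 le_rfl
    rw [h', zero_mul, ENNReal.toReal_zero, zero_smul]
    exact this
  · rw [hf.homogeneous _ _ h, ENNReal.ofReal_toReal q4.ne]

end DynamicOT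

end

open DynamicOT

/-!
The easy inequality, `sup ≤ C_D`, is the pointwise bound `⟨Y, z⟩ ≤ f x z` for `Y` in the polar
set, integrated against a solution of the continuity equation (`integral_le_action`).

For the converse, let `S` be the value of the dual problem, supposed finite, and regard a test
function `φ` as the continuous field `(∂ₜφ, ∇φ, φ)` on `[0, 1] × Ω`. The boundary term
`∫ φ(1) dρ₁ - ∫ φ(0) dρ₀` is a linear functional on the space of these fields, bounded by `S` on the convex
set `C` of fields with values in the polar sets `B(x)`. The field of `φ = -ε t` is an interior
point of `C` for small `ε` (`exists_box_subset_polarSet`): since `f > 0` off the axis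
`ω = 0, ζ = 0`, each `B(x)` contains a neighbourhood of `(-ε, 0, γ)` for all `|γ| ≤ ε`, and the size of `ε`
can be chosen uniformly by compactness and lower semicontinuity of `B`. Hence the Hahn–Banach
theorem (`exists_extension_le_of_convex`) extends the functional to all continuous fields, with
the same bound `S` on `C`. The Riesz theorem represents the extension by a triplet of signed
measures (`MeasureTriple.exists_integral_eq`). That it extends the boundary term is the continuity
equation, and it remains to see that its action is at most `S`.

This is the fact that the action is the supremum of `∫ ⟨Y, σ⟩ dl` over continuous selections
`Y ∈ C`, with `σ` the density of the triplet (`lintegral_le_of_forall_selection`). By the bipolar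
theorem `f x z` is the supremum of `⟨y, z⟩` over interior points `y` of `B(x)`, so over those in a
fixed countable dense set. The maxima over the first `n` points of this set increase to `f x (σ)`,
and each of them is an `L¹` limit of functions `⟨Y, σ⟩` with `Y ∈ C`: as `y ∈ int B(x)` is an open
condition on `x`, Urysohn functions can be used to move `Y` towards `y` where this increases the
pairing.

The minimum is thus attained if `S` is finite. If `S = ∞`, every solution of the continuity
equation is a minimizer, and there is one, `(0, 0, δ₁ ⊗ ρ₁ - δ₀ ⊗ ρ₀)`.
-/

noncomputable section

open Filter Topology

namespace DynamicOT

variable {d : ℕ} {Ω : Set (Space d)}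

/-! ### The duality pairing and polar sets -/

/-- The Euclidean pairing of `ℝ × ℝ^d × ℝ` with itself. (The norm of `Val d` is the sup norm of
the product, so this is not an `inner` of Mathlib.) -/
def pair (y z : Val d) : ℝ := y.1 * z.1 + inner ℝ y.2.1 z.2.1 + y.2.2 * z.2.2

lemma pair_add_left (y y' z : Val d) : pair (y + y') z = pair y z + pair y' z := by
  simp only [pair, Prod.fst_add, Prod.snd_add, inner_add_left]; ring

lemma pair_smul_left (c : ℝ) (y z : Val d) : pair (c • y) z = c * pair y z := by
  simp only [pair, Prod.smul_fst, Prod.smul_snd, real_inner_smul_left, smul_eq_mul]; ring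

lemma pair_sub_left (y y' z : Val d) : pair (y - y') z = pair y z - pair y' z := by
  simp only [pair, Prod.fst_sub, Prod.snd_sub, inner_sub_left]; ring

@[simp] lemma pair_zero_left (z : Val d) : pair 0 z = 0 := by simp [pair]

lemma continuous_pair : Continuous fun p : Val d × Val d => pair p.1 p.2 := by
  unfold pair; fun_prop

lemma abs_pair_le (y z : Val d) : |pair y z| ≤ 3 * ‖y‖ * ‖z‖ := by
  have h1 : |y.1 * z.1| ≤ ‖y‖ * ‖z‖ := by
    rw [abs_mul]
    exact mul_le_mul (norm_fst_le y) (norm_fst_le z) (abs_nonneg _) (norm_nonneg _)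
  have h2 : |inner ℝ y.2.1 z.2.1| ≤ ‖y‖ * ‖z‖ :=
    (abs_real_inner_le_norm _ _).trans <| mul_le_mul
      ((norm_fst_le y.2).trans (norm_snd_le y)) ((norm_fst_le z.2).trans (norm_snd_le z))
      (norm_nonneg _) (norm_nonneg _)
  have h3 : |y.2.2 * z.2.2| ≤ ‖y‖ * ‖z‖ := by
    rw [abs_mul]
    exact mul_le_mul ((norm_snd_le y.2).trans (norm_snd_le y))
      ((norm_snd_le z.2).trans (norm_snd_le z)) (abs_nonneg _) (norm_nonneg _)
  calc |pair y z| ≤ |y.1 * z.1| + |inner ℝ y.2.1 z.2.1| + |y.2.2 * z.2.2| := abs_add_three _ _ _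
    _ ≤ 3 * ‖y‖ * ‖z‖ := by linarith

lemma exists_pair_eq (L : Val d →L[ℝ] ℝ) : ∃ y, ∀ z, pair y z = L z := by
  refine ⟨(L (1, 0, 0), (InnerProductSpace.toDual ℝ (Space d)).symm
    (L.comp (.comp (.inr ℝ ℝ (Space d × ℝ)) (.inl ℝ (Space d) ℝ))), L (0, 0, 1)), fun z => ?_⟩
  have hz : z = z.1 • ((1, 0, 0) : Val d) + (0, z.2.1, 0) + z.2.2 • ((0, 0, 1) : Val d) := by
    ext <;> simp
  conv_rhs => rw [hz]
  simp only [pair, InnerProductSpace.toDual_symm_apply, map_add, map_smul, smul_eq_mul]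
  simp [mul_comm]

lemma mem_polarSet_iff {g : Val d → ℝ≥0∞} {y : Val d} :
    y ∈ polarSet g ↔ ∀ z, ENNReal.ofReal (pair y z) ≤ g z := by
  refine forall_congr' fun z => ?_
  rw [← EReal.coe_ennreal_le_coe_ennreal_iff, EReal.coe_ennreal_ofReal,
    EReal.coe_strictMono.monotone.map_max]
  simp [pair, EReal.coe_ennreal_nonneg]

lemma zero_mem_polarSet (g : Val d → ℝ≥0∞) : (0 : Val d) ∈ polarSet g :=
  mem_polarSet_iff.2 fun z => by simp

lemma convex_polarSet (g : Val d → ℝ≥0∞) : Convex ℝ (polarSet g) := by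
  intro y hy y' hy' a b ha hb hab
  rw [mem_polarSet_iff] at *
  intro z
  have h : pair (a • y + b • y') z ≤ max (pair y z) (pair y' z) := by
    rw [pair_add_left, pair_smul_left, pair_smul_left]
    calc _ ≤ a * max (pair y z) (pair y' z) + b * max (pair y z) (pair y' z) := by
          gcongr <;> simp
      _ = _ := by rw [← add_mul, hab, one_mul]
  refine (ENNReal.ofReal_le_ofReal h).trans ?_
  rw [ENNReal.ofReal_max]
  exact max_le (hy z) (hy' z)

lemma smul_mem_polarSet {g : Val d → ℝ≥0∞} {y : Val d} (hy : y ∈ polarSet g) {t : ℝ}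
    (h0 : 0 ≤ t) (h1 : t ≤ 1) : t • y ∈ polarSet g :=
  (convex_polarSet g).smul_mem_of_zero_mem (zero_mem_polarSet g) hy ⟨h0, h1⟩

/-- A closed convex positively homogeneous function is the support function of its polar set:
this is the Hahn–Banach separation of `(z, a)` from the epigraph. -/
lemma exists_mem_polarSet_lt_pair {g : Val d → ℝ≥0∞} (hc : ConvexOn ℝ≥0 univ g)
    (hh : ∀ t : ℝ, 0 < t → ∀ z, g (t • z) = ENNReal.ofReal t * g z)
    (hl : LowerSemicontinuous g) (h0 : g 0 = 0) {z : Val d} {a : ℝ} (ha : 0 ≤ a)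
    (haz : ENNReal.ofReal a < g z) : ∃ y ∈ polarSet g, a < pair y z := by
  let E : Set (Val d × ℝ) := {p | 0 ≤ p.2 ∧ g p.1 ≤ ENNReal.ofReal p.2}
  have hEc : IsClosed E := by
    refine (isClosed_le continuous_const continuous_snd).inter ?_
    exact hl.isClosed_epigraph.preimage
      (f := fun p : Val d × ℝ => (p.1, ENNReal.ofReal p.2))
      (continuous_fst.prodMk (ENNReal.continuous_ofReal.comp continuous_snd))
  have hEv : Convex ℝ E := by
    rintro ⟨z₁, t₁⟩ ⟨h1, h1'⟩ ⟨z₂, t₂⟩ ⟨h2, h2'⟩ s r hs hr hsr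
    simp only at h1 h1' h2 h2'
    refine ⟨by simp only [Prod.smul_mk, Prod.mk_add_mk, smul_eq_mul]; positivity, ?_⟩
    lift s to ℝ≥0 using hs
    lift r to ℝ≥0 using hr
    have := hc.2 (mem_univ z₁) (mem_univ z₂) (zero_le (a := s)) (zero_le (a := r))
      (by exact_mod_cast hsr)
    simp only [Prod.smul_mk, Prod.mk_add_mk, smul_eq_mul]
    refine this.trans ?_
    rw [ENNReal.ofReal_add (by positivity) (by positivity), ENNReal.ofReal_mul s.coe_nonneg,
      ENNReal.ofReal_mul r.coe_nonneg, ENNReal.ofReal_coe_nnreal, ENNReal.ofReal_coe_nnreal]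
    simp only [ENNReal.smul_def, smul_eq_mul]
    gcongr
  have hE0 : ((0, 0) : Val d × ℝ) ∈ E := ⟨le_rfl, by simp [h0]⟩
  have hEcone : ∀ p ∈ E, ∀ t : ℝ, 0 < t → t • p ∈ E := by
    rintro ⟨z, r⟩ ⟨h1, h2⟩ t ht
    refine ⟨mul_nonneg ht.le h1, ?_⟩
    simp only [Prod.smul_mk, smul_eq_mul, hh t ht, ENNReal.ofReal_mul ht.le]
    gcongr
  obtain ⟨F, u, hF, hFE⟩ := geometric_hahn_banach_point_closed hEv hEc
    (x := (z, a)) (fun h => absurd h.2 (not_le.2 haz))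
  have hu : u < 0 := by simpa [show ((0, 0) : Val d × ℝ) = 0 from rfl] using hFE _ hE0
  -- on a cone, a linear functional bounded below is nonnegative
  have hpos : ∀ p ∈ E, 0 ≤ F p := by
    intro p hp
    by_contra! h
    have h1 := hFE _ (hEcone p hp (u / F p) (div_pos_of_neg_of_neg hu h))
    rw [map_smul, smul_eq_mul, div_mul_cancel₀ _ h.ne] at h1
    exact lt_irrefl _ h1
  have hs : 0 ≤ F (0, 1) := hpos _ ⟨zero_le_one, by simp [h0]⟩
  have hdec : ∀ (w : Val d) (t : ℝ), F (w, t) = F (w, 0) + t * F (0, 1) := by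
    intro w t
    have : ((w, t) : Val d × ℝ) = (w, 0) + t • (0, 1) := by ext <;> simp
    rw [this, map_add, map_smul, smul_eq_mul]
  -- tilt the functional slightly, so that the hyperplane is not vertical
  obtain ⟨η, hη, hηa⟩ : ∃ η : ℝ, 0 < η ∧ F (z, a) + η * a < 0 := by
    have hFa : F (z, a) < 0 := hF.trans hu
    refine ⟨-F (z, a) / (2 * (a + 1)), div_pos (neg_pos.2 hFa) (by positivity), ?_⟩
    have : -F (z, a) / (2 * (a + 1)) * a ≤ -F (z, a) / 2 := by
      rw [div_mul_eq_mul_div, div_le_div_iff₀ (by positivity) (by positivity)]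
      nlinarith
    linarith
  set s := F (0, 1) + η with hsdef
  have hspos : 0 < s := by positivity
  obtain ⟨y, hy⟩ := exists_pair_eq (-(s⁻¹ • F.comp (.inl ℝ (Val d) ℝ)))
  have hy' : ∀ w, pair y w = -(s⁻¹ * F (w, 0)) := fun w => by rw [hy]; simp
  refine ⟨y, mem_polarSet_iff.2 fun w => ?_, ?_⟩
  · rcases eq_or_ne (g w) ∞ with h | h
    · rw [h]; exact le_top
    have h1 := hpos (w, (g w).toReal) ⟨ENNReal.toReal_nonneg, by rw [ENNReal.ofReal_toReal h]⟩
    rw [hdec] at h1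
    refine ENNReal.ofReal_le_of_le_toReal ?_
    have h3 : (0 : ℝ) ≤ (g w).toReal := ENNReal.toReal_nonneg
    rw [hy', neg_le, ← div_eq_inv_mul, le_div_iff₀ hspos]
    nlinarith [mul_nonneg h3 hη.le]
  · rw [hdec] at hηa
    rw [hy', lt_neg, ← div_eq_inv_mul, div_lt_iff₀ hspos]
    linarith

lemma exists_mem_interior_polarSet_lt_pair {g : Val d → ℝ≥0∞} (hc : ConvexOn ℝ≥0 univ g)
    (hh : ∀ t : ℝ, 0 < t → ∀ z, g (t • z) = ENNReal.ofReal t * g z)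
    (hl : LowerSemicontinuous g) (h0 : g 0 = 0) (hi : (interior (polarSet g)).Nonempty)
    {z : Val d} {a : ℝ} (ha : 0 ≤ a)
    (haz : ENNReal.ofReal a < g z) : ∃ y ∈ interior (polarSet g), a < pair y z := by
  obtain ⟨y, hy, hyz⟩ := exists_mem_polarSet_lt_pair hc hh hl h0 ha haz
  obtain ⟨y₀, hy₀⟩ := hi
  have hcont : Continuous fun t : ℝ => pair (y + t • (y₀ - y)) z :=
    continuous_pair.comp (f := fun t : ℝ => (y + t • (y₀ - y), z)) (by fun_prop)
  have h1 : ∀ᶠ t in 𝓝[>] (0 : ℝ), a < pair (y + t • (y₀ - y)) z :=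
    (hcont.tendsto 0).mono_left nhdsWithin_le_nhds |>.eventually
      (lt_mem_nhds (by simpa using hyz))
  obtain ⟨t, ht, ht'⟩ := (h1.and (Ioc_mem_nhdsGT one_pos)).exists
  exact ⟨_, (convex_polarSet g).add_smul_sub_mem_interior hy hy₀ ht', ht⟩

/-! ### Interior points of the polar sets -/

namespace IsInfinitesimalCost
variable {f : Ω → Val d → ℝ≥0∞}

lemma map_zero (hf : IsInfinitesimalCost f) (x : Ω) : f x 0 = 0 := hf.eq_zero x 0 le_rfl

/-- The polar set of `f x` contains, for small `ε`, a neighbourhood of `(-ε, 0, γ)` for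
all `|γ| < 2 ε`. The point is that `γ` may be larger than `ε`: on `ρ ≥ 4 |(ω, ζ)|` the negative
first component pays for this, and on `ρ ≤ 4 |(ω, ζ)|` the function `f x` is bounded below
by a multiple of `|(ω, ζ)|`. -/
lemma exists_mem_polarSet_of_lt (hf : IsInfinitesimalCost f) (x : Ω) :
    ∃ ε > 0, ∀ y : Val d, y.1 < -(ε / 2) → ‖y.2.1‖ + |y.2.2| < 2 * ε → y ∈ polarSet (f x) := by
  have hK : IsCompact (Icc (0 : ℝ) 4 ×ˢ Metric.sphere (0 : Space d × ℝ) 1) :=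
    isCompact_Icc.prod (isCompact_sphere _ _)
  obtain ⟨⟨ρ₀, w₀⟩, ⟨-, hw₀⟩, hmin⟩ :=
    ((hf.lowerSemicontinuous x).lowerSemicontinuousOn _).exists_isMinOn
      ⟨((0, 0, 1) : Val d), by simp [Prod.norm_def]⟩ hK
  have hpos : 0 < f x (ρ₀, w₀) := by
    refine hf.pos x _ _ _ ?_
    by_contra! h
    have : w₀ = 0 := Prod.ext h.1 h.2
    simp [this] at hw₀
  obtain ⟨c, hc, hcle⟩ : ∃ c : ℝ, 0 < c ∧ ENNReal.ofReal c ≤ f x (ρ₀, w₀) := by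
    obtain ⟨c, h1, h2⟩ := ENNReal.lt_iff_exists_real_btwn.1 hpos
    exact ⟨c, by simpa using h2.1, h2.2.le⟩
  refine ⟨c / 2, by positivity, fun y hy1 hy2 => mem_polarSet_iff.2 fun ⟨ρ, w⟩ => ?_⟩
  rcases lt_or_ge ρ 0 with hρ | hρ
  · rw [hf.eq_top x _ _ _ hρ]; exact le_top
  have hpair : pair y (ρ, w) ≤ -(c / 4) * ρ + c * ‖w‖ := by
    have h1 : inner ℝ y.2.1 w.1 ≤ ‖y.2.1‖ * ‖w‖ :=
      (real_inner_le_norm _ _).trans (by gcongr; exact norm_fst_le w)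
    have h2 : y.2.2 * w.2 ≤ |y.2.2| * ‖w‖ := by
      refine (le_abs_self _).trans ?_
      rw [abs_mul]; gcongr; exact norm_snd_le w
    have h3 : y.1 * ρ ≤ -(c / 4) * ρ := by gcongr; linarith
    have h4 : (‖y.2.1‖ + |y.2.2|) * ‖w‖ ≤ c * ‖w‖ := by gcongr; linarith
    simp only [pair]
    linarith
  rcases le_or_gt (4 * ‖w‖) ρ with h | h
  · rw [ENNReal.ofReal_of_nonpos (by nlinarith)]; exact zero_le
  have hw : 0 < ‖w‖ := by linarith
  have hfz : f x (ρ, w) = ENNReal.ofReal ‖w‖ * f x (ρ / ‖w‖, ‖w‖⁻¹ • w) := by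
    rw [← hf.homogeneous x _ hw]
    congr 1
    rw [Prod.smul_mk, smul_smul, mul_inv_cancel₀ hw.ne', one_smul, smul_eq_mul,
      mul_div_cancel₀ _ hw.ne']
  have hmem : ((ρ / ‖w‖, ‖w‖⁻¹ • w) : Val d) ∈
      Icc (0 : ℝ) 4 ×ˢ Metric.sphere (0 : Space d × ℝ) 1 := by
    refine ⟨⟨by positivity, ?_⟩, ?_⟩
    · rw [div_le_iff₀ hw]; exact h.le
    · simp [norm_smul, hw.ne']
  rw [hfz]
  calc ENNReal.ofReal (pair y (ρ, w)) ≤ ENNReal.ofReal (‖w‖ * c) :=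
        ENNReal.ofReal_le_ofReal (by nlinarith)
    _ = ENNReal.ofReal ‖w‖ * ENNReal.ofReal c := ENNReal.ofReal_mul hw.le
    _ ≤ _ := by gcongr; exact hcle.trans (isMinOn_iff.1 hmin _ hmem)

/-- The box of radius `ε / 4` around the segment of all `(-ε, 0, γ)` with `|γ| ≤ ε`. -/
def box (d : ℕ) (ε : ℝ) : Set (Val d) :=
  Metric.closedBall (-ε) (ε / 4) ×ˢ Metric.closedBall (0 : Space d) (ε / 4) ×ˢ
    Metric.closedBall (0 : ℝ) (5 * ε / 4)

lemma mem_box {ε : ℝ} {y : Val d} :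
    y ∈ box d ε ↔ |y.1 + ε| ≤ ε / 4 ∧ ‖y.2.1‖ ≤ ε / 4 ∧ |y.2.2| ≤ 5 * ε / 4 := by
  simp [box, Set.mem_prod, Real.dist_eq]

lemma smul_mem_box {ε t : ℝ} (ht : 0 ≤ t) {y : Val d} (hy : y ∈ box d ε) :
    t • y ∈ box d (t * ε) := by
  rw [mem_box] at *
  obtain ⟨h1, h2, h3⟩ := hy
  simp only [Prod.smul_fst, Prod.smul_snd, smul_eq_mul, norm_smul, ← mul_add, abs_mul,
    Real.norm_eq_abs, abs_of_nonneg ht]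
  refine ⟨?_, ?_, ?_⟩
  · linarith [mul_le_mul_of_nonneg_left h1 ht]
  · linarith [mul_le_mul_of_nonneg_left h2 ht]
  · linarith [mul_le_mul_of_nonneg_left h3 ht]

lemma exists_box_subset_interior (hf : IsInfinitesimalCost f) (x : Ω) :
    ∃ ε > 0, box d ε ⊆ interior (polarSet (f x)) := by
  obtain ⟨ε, hε, h⟩ := hf.exists_mem_polarSet_of_lt x
  let W : Set (Val d) := {y | y.1 < -(ε / 2) ∧ ‖y.2.1‖ + |y.2.2| < 2 * ε}
  have hW : IsOpen W :=
    (isOpen_lt (f := fun y : Val d => y.1) (by fun_prop) continuous_const).inter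
      (isOpen_lt (f := fun y : Val d => ‖y.2.1‖ + |y.2.2|) (by fun_prop) continuous_const)
  refine ⟨ε, hε, fun y hy => interior_maximal (fun y hy => h y hy.1 hy.2) hW ?_⟩
  obtain ⟨h1, h2, h3⟩ := mem_box.1 hy
  exact ⟨by linarith [(abs_le.1 h1).2], by linarith⟩

/-- By compactness of `Ω` and lower semicontinuity of the polar sets, the box of some size `ε` is
contained in all polar sets at once. -/
lemma exists_box_subset_polarSet (hΩ : IsCompact Ω) (hf : IsInfinitesimalCost f)
    (hB : IsLSCMultifunction (fun x : Ω => polarSet (f x))) :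
    ∃ ε > 0, ∀ x, box d ε ⊆ polarSet (f x) := by
  have : CompactSpace Ω := isCompact_iff_compactSpace.1 hΩ
  have key : ∃ ε > 0, ∀ x ∈ (univ : Set Ω), ∀ ε' > 0, ε' ≤ ε → box d ε' ⊆ polarSet (f x) := by
    refine isCompact_univ.induction_on
      (p := fun s => ∃ ε > 0, ∀ x ∈ s, ∀ ε' > 0, ε' ≤ ε → box d ε' ⊆ polarSet (f x)) ?_ ?_ ?_ ?_
    · exact ⟨1, one_pos, by simp⟩
    · rintro s t hst ⟨ε, hε, h⟩
      exact ⟨ε, hε, fun x hx => h x (hst hx)⟩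
    · rintro s t ⟨ε, hε, h⟩ ⟨ε₂, hε₂, h₂⟩
      refine ⟨min ε ε₂, lt_min hε hε₂, ?_⟩
      rintro x (hx | hx) ε' hε' hle
      · exact h x hx ε' hε' (hle.trans (min_le_left _ _))
      · exact h₂ x hx ε' hε' (hle.trans (min_le_right _ _))
    · intro x _
      obtain ⟨ε, hε, h⟩ := hf.exists_box_subset_interior x
      have hbox : IsCompact (box d ε) :=
        (isCompact_closedBall _ _).prod ((isCompact_closedBall _ _).prod (isCompact_closedBall _ _))
      obtain ⟨u, v, hu, -, hxu, hv, huv⟩ := generalized_tube_lemma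
        (isCompact_singleton (x := x)) hbox hB (by rintro ⟨x', y⟩ ⟨rfl, hy⟩; exact h hy)
      refine ⟨u, mem_nhdsWithin_of_mem_nhds (hu.mem_nhds (hxu rfl)), ε, hε,
        fun x' hx' ε' hε' hle y hy => ?_⟩
      have h1 : (ε / ε') • y ∈ polarSet (f x') := by
        refine interior_subset (huv (mk_mem_prod hx' (hv ?_)))
        have := smul_mem_box (t := ε / ε') (by positivity) hy
        rwa [div_mul_cancel₀ _ hε'.ne'] at this
      have h2 := smul_mem_polarSet h1 (t := ε' / ε) (by positivity) ((div_le_one hε).2 hle)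
      rwa [smul_smul, div_mul_div_comm, mul_comm ε', div_self (mul_pos hε hε').ne', one_smul] at h2
  obtain ⟨ε, hε, h⟩ := key
  exact ⟨ε, hε, fun x => h x (mem_univ x) ε hε le_rfl⟩

/-- The function `f x` is the supremum of the pairings with interior points of its polar set. -/
lemma exists_mem_interior_lt_pair (hf : IsInfinitesimalCost f) (x : Ω) {z : Val d} {a : ℝ}
    (ha : 0 ≤ a) (haz : ENNReal.ofReal a < f x z) :
    ∃ y ∈ interior (polarSet (f x)), a < pair y z := by
  obtain ⟨ε, hε, h⟩ := hf.exists_box_subset_interior x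
  refine exists_mem_interior_polarSet_lt_pair (hf.convexOn x) (hf.homogeneous x)
    (hf.lowerSemicontinuous x) (hf.map_zero x) ⟨((-ε, 0, 0) : Val d), h ?_⟩ ha haz
  rw [mem_box]
  simp only [neg_add_cancel, abs_zero, norm_zero]
  exact ⟨by positivity, by positivity, by positivity⟩

end IsInfinitesimalCost

/-! ### Integrals against signed measures and the signed Riesz representation theorem -/

lemma vectorIntegral_sub_toSignedMeasure {X : Type*} [MeasurableSpace X] (k l : Measure X)
    [IsFiniteMeasure k] [IsFiniteMeasure l] {g : X → ℝ} (hk : Integrable g k)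
    (hl : Integrable g l) :
    ∫ᵛ x, g x ∂<•(k.toSignedMeasure - l.toSignedMeasure) = ∫ x, g x ∂k - ∫ x, g x ∂l := by
  rw [VectorMeasure.integral_sub_vectorMeasure, VectorMeasure.integral_toSignedMeasure,
    VectorMeasure.integral_toSignedMeasure]
  · simpa [VectorMeasure.Integrable] using hk
  · simpa [VectorMeasure.Integrable] using hl

lemma vectorIntegral_eq_integral_mul_rnDeriv {X : Type*} [MeasurableSpace X]
    (s : SignedMeasure X) (l : Measure X) [IsFiniteMeasure l] (h : s.totalVariation ≪ l)
    {g : X → ℝ} (hg : Measurable g) {C : ℝ} (hC : ∀ x, ‖g x‖ ≤ C) :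
    ∫ᵛ x, g x ∂<•s = ∫ x, g x * s.rnDeriv l x ∂l := by
  have hp : s.toJordanDecomposition.posPart ≪ l :=
    (Measure.le_add_right le_rfl).absolutelyContinuous.trans h
  have hn : s.toJordanDecomposition.negPart ≪ l :=
    (Measure.le_add_left le_rfl).absolutelyContinuous.trans h
  have hint : ∀ k : Measure X, [IsFiniteMeasure k] → Integrable g k := fun k _ =>
    Integrable.of_bound hg.aestronglyMeasurable C (ae_of_all _ hC)
  have hint' : ∀ k : Measure X, [IsFiniteMeasure k] →
      Integrable (fun x => (k.rnDeriv l x).toReal • g x) l := fun k _ =>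
    Measure.integrable_toReal_rnDeriv.mul_bdd hg.aestronglyMeasurable (ae_of_all _ hC)
  conv_lhs => rw [← s.toSignedMeasure_toJordanDecomposition, JordanDecomposition.toSignedMeasure]
  rw [vectorIntegral_sub_toSignedMeasure _ _ (hint _) (hint _), ← integral_rnDeriv_smul hp,
    ← integral_rnDeriv_smul hn, ← integral_sub (hint' _) (hint' _)]
  congr 1 with x
  rw [SignedMeasure.rnDeriv_def, smul_eq_mul, smul_eq_mul]
  ring

variable {X : Type*} [TopologicalSpace X] [CompactSpace X] [T2Space X] [MeasurableSpace X]
  [BorelSpace X]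

lemma exists_measure_of_nonneg (Λ : C(X, ℝ) →ₗ[ℝ] ℝ) (hΛ : ∀ g, 0 ≤ g → 0 ≤ Λ g) :
    ∃ μ : Measure X, IsFiniteMeasure μ ∧ ∀ g : C(X, ℝ), Λ g = ∫ x, g x ∂μ := by
  let Λ' : CompactlySupportedContinuousMap X ℝ →ₚ[ℝ] ℝ :=
    { toFun := fun g => Λ g.toContinuousMap
      map_add' := fun g h => Λ.map_add _ _
      map_smul' := fun c g => Λ.map_smul _ _
      monotone' := fun g h hgh => by
        have := hΛ (h.toContinuousMap - g.toContinuousMap) (sub_nonneg.2 hgh)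
        rwa [map_sub, sub_nonneg] at this }
  refine ⟨RealRMK.rieszMeasure Λ', inferInstance, fun g => ?_⟩
  exact (RealRMK.integral_rieszMeasure Λ'
    ⟨g, HasCompactSupport.of_compactSpace _⟩).symm

/-- A bounded functional on `C(X)` is a difference of two finite measures. The decomposition into
positive functionals comes from the Hahn–Banach theorem on `C(X) × C(X)`: extend
`(g, -g) ↦ ℓ g` from the antidiagonal to `(g, h) ↦ Λ₁ g + Λ₂ h`, dominated by
`‖ℓ‖ (‖g⁺‖ + ‖h⁺‖)`. The domination forces `Λ₁` and `Λ₂` to be positive. -/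
theorem exists_measure_sub (ℓ : C(X, ℝ) →L[ℝ] ℝ) :
    ∃ k l : Measure X, IsFiniteMeasure k ∧ IsFiniteMeasure l ∧
      ∀ g : C(X, ℝ), ℓ g = ∫ x, g x ∂k - ∫ x, g x ∂l := by
  let D : Submodule ℝ (C(X, ℝ) × C(X, ℝ)) :=
    LinearMap.range (LinearMap.prod LinearMap.id (-LinearMap.id))
  let N : C(X, ℝ) × C(X, ℝ) → ℝ := fun p => ‖ℓ‖ * (‖p.1 ⊔ 0‖ + ‖p.2 ⊔ 0‖)
  have hadd : ∀ g h : C(X, ℝ), ‖(g + h) ⊔ 0‖ ≤ ‖g ⊔ 0‖ + ‖h ⊔ 0‖ := fun g h => by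
    refine (ContinuousMap.norm_le _ (by positivity)).2 fun x => ?_
    have h1 := (g ⊔ 0).norm_coe_le_norm x
    have h2 := (h ⊔ 0).norm_coe_le_norm x
    simp only [ContinuousMap.sup_apply, ContinuousMap.add_apply, ContinuousMap.zero_apply,
      Real.norm_eq_abs] at *
    rw [abs_of_nonneg (le_max_right _ _)] at *
    refine le_trans (max_le ?_ ?_) (add_le_add h1 h2)
    · exact add_le_add (le_max_left _ _) (le_max_left _ _)
    · exact add_nonneg (le_max_right _ _) (le_max_right _ _)
  have hsmul : ∀ (c : ℝ) (g : C(X, ℝ)), 0 < c → ‖(c • g) ⊔ 0‖ = c * ‖g ⊔ 0‖ := fun c g hc => by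
    have : (c • g) ⊔ 0 = c • (g ⊔ 0) := by
      ext x
      simp [mul_max_of_nonneg _ _ hc.le]
    rw [this, norm_smul, Real.norm_of_nonneg hc.le]
  obtain ⟨Φ, hΦ, hΦN⟩ := exists_extension_of_le_sublinear
    ((ℓ.toLinearMap ∘ₗ LinearMap.fst ℝ _ _).toPMap D) N
    (fun c hc p => by simp only [N, Prod.smul_fst, Prod.smul_snd, hsmul c _ hc]; ring)
    (fun p q => by
      simp only [N, ← mul_add]
      refine mul_le_mul_of_nonneg_left ?_ (norm_nonneg ℓ)
      exact (add_le_add (hadd p.1 q.1) (hadd p.2 q.2)).trans_eq (add_add_add_comm _ _ _ _))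
    (by
      rintro ⟨_, g, rfl⟩
      have h1 : g = (g ⊔ 0) - (-g ⊔ 0) := by
        ext x
        rcases le_total (g x) 0 with h | h <;> simp [h]
      have h2 : ‖g‖ ≤ ‖g ⊔ 0‖ + ‖-g ⊔ 0‖ := by
        conv_lhs => rw [h1]
        exact norm_sub_le _ _
      exact (le_abs_self _).trans ((ℓ.le_opNorm g).trans
        (mul_le_mul_of_nonneg_left h2 (norm_nonneg _))))
  have hneg : ∀ g : C(X, ℝ), 0 ≤ g → ‖-g ⊔ 0‖ = 0 := fun g hg => by
    rw [sup_eq_right.2 (neg_nonpos.2 hg), norm_zero]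
  obtain ⟨k, hk, hk'⟩ := exists_measure_of_nonneg (Φ ∘ₗ LinearMap.inl ℝ _ _) fun g hg => by
    have h := hΦN (-g, 0)
    simp only [N, hneg g hg, sup_idem, norm_zero, add_zero, mul_zero] at h
    have h' := Φ.map_neg (g, 0)
    simp only [Prod.neg_mk, neg_zero] at h'
    simp only [LinearMap.comp_apply, LinearMap.inl_apply]
    linarith
  obtain ⟨l, hl, hl'⟩ := exists_measure_of_nonneg (Φ ∘ₗ LinearMap.inr ℝ _ _) fun g hg => by
    have h := hΦN (0, -g)
    simp only [N, hneg g hg, sup_idem, norm_zero, add_zero, mul_zero] at h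
    have h' := Φ.map_neg (0, g)
    simp only [Prod.neg_mk, neg_zero] at h'
    simp only [LinearMap.comp_apply, LinearMap.inr_apply]
    linarith
  refine ⟨k, l, hk, hl, fun g => ?_⟩
  have h1 : Φ (g, -g) = ℓ g := hΦ ⟨(g, -g), g, rfl⟩
  rw [← hk', ← hl', ← h1, LinearMap.comp_apply, LinearMap.comp_apply, ← map_sub]
  simp

/-! ### Extension of linear functionals bounded on a convex set -/

/-- A Hahn–Banach theorem: a linear functional that is at most `S` on `L ∩ C` extends from
the subspace `L` to a continuous functional that is at most `S` on `C`, provided that `L` meets the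
interior of the convex set `C`. -/
theorem exists_extension_le_of_convex {E : Type*} [NormedAddCommGroup E] [NormedSpace ℝ E]
    {L : Submodule ℝ E} (b : E →ₗ[ℝ] ℝ) {C : Set E} (hC : Convex ℝ C) {y₀ : E} (hy₀ : y₀ ∈ L)
    {r : ℝ} (hr : 0 < r) (hball : Metric.ball y₀ r ⊆ C) {S : ℝ}
    (hS : ∀ y ∈ L, y ∈ C → b y ≤ S) :
    ∃ ℓ : E →L[ℝ] ℝ, (∀ y ∈ L, ℓ y = b y) ∧ ∀ y ∈ C, ℓ y ≤ S := by
  -- after translating `y₀` to the origin, the bound is domination by a multiple of the gauge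
  set C' : Set E := (fun y => y₀ + y) ⁻¹' C with hC'
  have hconv : Convex ℝ C' := hC.translate_preimage_right y₀
  have hball' : Metric.ball (0 : E) r ⊆ C' := fun y hy => hball (by simpa using hy)
  have habs : Absorbent ℝ C' :=
    absorbent_nhds_zero (mem_of_superset (Metric.ball_mem_nhds 0 hr) hball')
  have hs : 0 ≤ S - b y₀ :=
    sub_nonneg.2 (hS y₀ hy₀ (hball (Metric.mem_ball_self hr)))
  set s := S - b y₀ with hsdef
  obtain ⟨ℓ, hℓ, hℓN⟩ := exists_extension_of_le_sublinear (b.toPMap L) (fun y => s * gauge C' y)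
    (fun c hc y => by simp only [gauge_smul_of_nonneg hc.le, smul_eq_mul]; ring)
    (fun x y => by
      rw [← mul_add]
      exact mul_le_mul_of_nonneg_left (gauge_add_le hconv habs x y) hs)
    (by
      -- `y` is `t • w` with `y₀ + w ∈ L ∩ C` and `t` arbitrarily close to the gauge of `y`
      rintro ⟨y, hy⟩
      refine le_of_forall_pos_le_add fun ε hε => ?_
      obtain ⟨t, ht, htlt, w, hw, rfl⟩ := exists_lt_of_gauge_lt habs
        (lt_add_of_pos_right (gauge C' y) (show 0 < ε / (s + 1) by positivity))
      have hwL : w ∈ L := (L.smul_mem_iff ht.ne').1 hy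
      have hbw : b w ≤ s := by
        have := hS _ (L.add_mem hy₀ hwL) hw
        rw [map_add] at this
        linarith
      have h1 : s * (ε / (s + 1)) ≤ ε := by
        rw [mul_div_assoc', div_le_iff₀ (by positivity)]
        nlinarith
      calc b (t • w) = t * b w := by rw [map_smul, smul_eq_mul]
        _ ≤ t * s := by gcongr
        _ ≤ (gauge C' (t • w) + ε / (s + 1)) * s := by gcongr
        _ ≤ s * gauge C' (t • w) + ε := by linarith)
  have hbound : ∀ y, ℓ y ≤ s / r * ‖y‖ := fun y => by
    refine (hℓN y).trans ?_
    have := mul_gauge_le_norm (x := y) hball'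
    rw [div_mul_eq_mul_div, le_div_iff₀ hr]
    nlinarith
  refine ⟨ℓ.mkContinuous (s / r) fun y => ?_, fun y hy => hℓ ⟨y, hy⟩, fun y hy => ?_⟩
  · refine abs_le'.2 ⟨hbound y, ?_⟩
    simpa using hbound (-y)
  · have h1 : ℓ (y - y₀) ≤ s * 1 := (hℓN _).trans
      (mul_le_mul_of_nonneg_left (gauge_le_one_of_mem (by simpa [hC'] using hy)) hs)
    have h2 : ℓ y₀ = b y₀ := hℓ ⟨y₀, hy₀⟩
    rw [map_sub] at h1
    change ℓ y ≤ S
    linarith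

/-! ### Integration of suprema over continuous selections -/

section Selection

variable {X : Type*}

open scoped Classical in
/-- Successive maxima of the functions `⟨y, σ⟩`, each taken where `y` is an interior value
of `B`, with `y` running through the dense sequence of `Val d`. -/
def selectionMax (B : X → Set (Val d)) (σ : X → Val d) : ℕ → X → ℝ
  | 0, _ => 0
  | n + 1, x =>
    if x ∈ {x | TopologicalSpace.denseSeq (Val d) n ∈ interior (B x)} ∧
        selectionMax B σ n x < pair (TopologicalSpace.denseSeq (Val d) n) (σ x) then
      pair (TopologicalSpace.denseSeq (Val d) n) (σ x) else selectionMax B σ n x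

lemma monotone_selectionMax (B : X → Set (Val d)) (σ : X → Val d) (x : X) :
    Monotone fun n => selectionMax B σ n x := by
  refine monotone_nat_of_le_succ fun n => ?_
  rw [selectionMax]
  split_ifs with h
  · exact h.2.le
  · exact le_rfl

lemma selectionMax_nonneg (B : X → Set (Val d)) (σ : X → Val d) (n : ℕ) (x : X) :
    0 ≤ selectionMax B σ n x :=
  monotone_selectionMax B σ x (Nat.zero_le n)

lemma exists_lt_selectionMax {B : X → Set (Val d)} {σ : X → Val d} {x : X} {a : ℝ}
    (h : ∃ y ∈ interior (B x), a < pair y (σ x)) : ∃ n, a < selectionMax B σ n x := by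
  obtain ⟨y, hy, hay⟩ := h
  have hopen : IsOpen (interior (B x) ∩ {y | a < pair y (σ x)}) :=
    isOpen_interior.inter (isOpen_lt continuous_const
      (continuous_pair.comp (f := fun y => (y, σ x)) (by fun_prop)))
  obtain ⟨n, h1, h2⟩ :=
    (TopologicalSpace.denseRange_denseSeq (Val d)).exists_mem_open hopen ⟨y, hy, hay⟩
  refine ⟨n + 1, ?_⟩
  rw [selectionMax]
  split_ifs with hif
  · exact h2
  · exact lt_of_lt_of_le h2 (not_lt.1 fun hlt => hif ⟨h1, hlt⟩)

variable [TopologicalSpace X] [CompactSpace X] [MeasurableSpace X] [BorelSpace X]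

lemma integrable_pair (l : Measure X) [IsFiniteMeasure l] {σ : X → Val d} (hσ : Integrable σ l)
    (Y : C(X, Val d)) : Integrable (fun x => pair (Y x) (σ x)) l := by
  refine (hσ.norm.const_mul (3 * ‖Y‖)).mono' ?_ (ae_of_all _ fun x => ?_)
  · exact continuous_pair.comp_aestronglyMeasurable
      (Y.continuous.aestronglyMeasurable.prodMk hσ.aestronglyMeasurable)
  · refine (abs_pair_le _ _).trans ?_
    gcongr
    exact Y.norm_coe_le_norm x

/-- `G` is a limit in `L¹(l)` of functions `x ↦ ⟨Y x, σ x⟩`, with `Y` a continuous selection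
of `B`. -/
def IsSelectionLimit (B : X → Set (Val d)) (σ : X → Val d) (l : Measure X) (G : X → ℝ) : Prop :=
  Measurable G ∧ ∀ ε : ℝ≥0∞, ε ≠ 0 →
    ∃ Y : C(X, Val d), (∀ x, Y x ∈ B x) ∧ ∫⁻ x, ‖G x - pair (Y x) (σ x)‖ₑ ∂l ≤ ε

variable [TopologicalSpace.PseudoMetrizableSpace X]

open scoped Classical in
/-- On an open set where `y` is a value of `B`, a selection limit may be replaced by its maximum
with `⟨y, σ⟩`: a selection `Y` for `G` is moved to `Y + θ (y - Y)`, where `θ` is a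
Urysohn function close to the indicator function of the set where the maximum is `⟨y, σ⟩`. -/
lemma IsSelectionLimit.max {B : X → Set (Val d)} (hB : ∀ x, Convex ℝ (B x)) {σ : X → Val d}
    (hσm : Measurable σ) {l : Measure X} [IsFiniteMeasure l] (hσ : Integrable σ l) {G : X → ℝ}
    (hG : IsSelectionLimit B σ l G) {y : Val d} {U : Set X} (hU : IsOpen U)
    (hUB : ∀ x ∈ U, y ∈ B x) :
    IsSelectionLimit B σ l
      (fun x => if x ∈ U ∧ G x < pair y (σ x) then pair y (σ x) else G x) := by
  have hpm : ∀ Y : C(X, Val d), Measurable fun x => pair (Y x) (σ x) := fun Y =>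
    continuous_pair.measurable.comp (Y.continuous.measurable.prodMk hσm)
  have hqm : Measurable fun x => pair y (σ x) := hpm (.const X y)
  set E : Set X := {x | x ∈ U ∧ G x < pair y (σ x)} with hEdef
  have hE : MeasurableSet E := hU.measurableSet.inter (measurableSet_lt hG.1 hqm)
  refine ⟨Measurable.ite hE hqm hG.1, fun ε hε => ?_⟩
  have hε2 : ε / 2 ≠ 0 := by simpa using hε
  have hε4 : ε / 2 / 2 ≠ 0 := by simpa using hε
  obtain ⟨Y, hYB, hY⟩ := hG.2 (ε / 2) hε2
  have hGm := hG.1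
  have hYm := hpm Y
  -- `ν` weights a set by the error made on it by choosing between `Y` and `y` wrongly
  set ν : Measure X := l.withDensity fun x => ‖pair y (σ x) - pair (Y x) (σ x)‖ₑ with hν
  have : IsFiniteMeasure ν := isFiniteMeasure_withDensity
    ((integrable_pair l hσ (.const X y)).sub (integrable_pair l hσ Y)).2.ne
  obtain ⟨F, hFE, hF, hFν⟩ := hE.exists_isClosed_sdiff_lt (measure_ne_top ν E) hε4
  obtain ⟨O, hEO, hO, -, hOν⟩ := hE.exists_isOpen_sdiff_lt (measure_ne_top ν E) hε4
  have hFOU : Disjoint (O ∩ U)ᶜ F :=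
    disjoint_compl_left_iff_subset.2 fun x hx => ⟨hEO (hFE hx), (hFE hx).1⟩
  obtain ⟨θ, hθ0, hθ1, hθ⟩ :=
    exists_continuous_zero_one_of_isClosed (hO.inter hU).isClosed_compl hF hFOU
  let Y' : C(X, Val d) := ⟨fun x => Y x + θ x • (y - Y x), by fun_prop⟩
  refine ⟨Y', fun x => ?_, ?_⟩
  · by_cases hx : x ∈ O ∩ U
    · exact (hB x).add_smul_sub_mem (hYB x) (hUB x hx.2) (hθ x)
    · simpa [Y', hθ0 hx] using hYB x
  -- outside `O \ F`, `θ` is the indicator function of `E`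
  set bad : Set X := O \ F with hbad
  have hbadm : MeasurableSet bad := hO.measurableSet.diff hF.measurableSet
  have hbadν : ν bad ≤ ε / 2 := by
    calc ν bad ≤ ν ((O \ E) ∪ (E \ F)) := measure_mono fun x hx => by
          by_cases h : x ∈ E
          · exact Or.inr ⟨h, hx.2⟩
          · exact Or.inl ⟨hx.1, h⟩
      _ ≤ ν (O \ E) + ν (E \ F) := measure_union_le _ _
      _ ≤ ε / 2 / 2 + ε / 2 / 2 := add_le_add hOν.le hFν.le
      _ = ε / 2 := ENNReal.add_halves _
  have hpt : ∀ x, ‖(if x ∈ E then pair y (σ x) else G x) - pair (Y' x) (σ x)‖ₑ ≤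
      ‖G x - pair (Y x) (σ x)‖ₑ +
        bad.indicator (fun x => ‖pair y (σ x) - pair (Y x) (σ x)‖ₑ) x := fun x => by
    have hY' : pair (Y' x) (σ x) =
        pair (Y x) (σ x) + θ x * (pair y (σ x) - pair (Y x) (σ x)) := by
      simp only [Y', ContinuousMap.coe_mk, pair_add_left, pair_smul_left, pair_sub_left]
    rw [hY']
    by_cases hxF : x ∈ F
    · simp [hFE hxF, hθ1 hxF]
    by_cases hxO : x ∈ O
    · have hxb : x ∈ bad := ⟨hxO, hxF⟩
      rw [indicator_of_mem hxb]
      obtain ⟨h0, h1⟩ := hθ x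
      by_cases hxE : x ∈ E
      · rw [if_pos hxE]
        refine le_trans ?_ le_add_self
        rw [enorm_le_iff_norm_le, Real.norm_eq_abs, Real.norm_eq_abs,
          show ∀ q p t : ℝ, q - (p + t * (q - p)) = (1 - t) * (q - p) by intros; ring, abs_mul,
          abs_of_nonneg (sub_nonneg.2 h1)]
        exact mul_le_of_le_one_left (abs_nonneg _) (by linarith)
      · rw [if_neg hxE, show ∀ g q p t : ℝ, g - (p + t * (q - p)) = (g - p) - t * (q - p) by
          intros; ring]
        refine (enorm_sub_le).trans (add_le_add_right ?_ _)
        rw [enorm_le_iff_norm_le, Real.norm_eq_abs, Real.norm_eq_abs, abs_mul, abs_of_nonneg h0]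
        exact mul_le_of_le_one_left (abs_nonneg _) h1
    · have hxE : x ∉ E := fun h => hxO (hEO h)
      have : θ x = 0 := hθ0 fun h => hxO h.1
      simp [hxE, this]
  calc _ ≤ ∫⁻ x, (‖G x - pair (Y x) (σ x)‖ₑ +
        bad.indicator (fun x => ‖pair y (σ x) - pair (Y x) (σ x)‖ₑ) x) ∂l :=
        lintegral_mono hpt
    _ = ∫⁻ x, ‖G x - pair (Y x) (σ x)‖ₑ ∂l + ν bad := by
        rw [lintegral_add_left (by fun_prop), lintegral_indicator hbadm, hν,
          withDensity_apply _ hbadm]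
    _ ≤ ε / 2 + ε / 2 := add_le_add hY hbadν
    _ = ε := ENNReal.add_halves _

lemma isSelectionLimit_selectionMax {B : X → Set (Val d)} (hB : ∀ x, Convex ℝ (B x))
    (hB0 : ∀ x, 0 ∈ B x) (hBo : IsLSCMultifunction B) {σ : X → Val d}
    (hσm : Measurable σ) {l : Measure X} [IsFiniteMeasure l] (hσ : Integrable σ l) (n : ℕ) :
    IsSelectionLimit B σ l (selectionMax B σ n) := by
  induction n with
  | zero => exact ⟨measurable_const, fun ε _ => ⟨0, hB0, by simp [selectionMax]⟩⟩
  | succ n ih =>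
    exact ih.max hB hσm hσ (hBo.preimage (f := fun x => (x, _)) (by fun_prop))
      fun x hx => interior_subset hx

/-- If the continuous selections `Y` of a lower semicontinuous convex-valued multifunction `B` all
satisfy `∫ ⟨Y, σ⟩ ≤ S`, then `S` also bounds the integral of any function that is pointwise at most
the support function of `B` at `σ`. -/
theorem lintegral_le_of_forall_selection {B : X → Set (Val d)} (hB : ∀ x, Convex ℝ (B x))
    (hB0 : ∀ x, 0 ∈ B x) (hBo : IsLSCMultifunction B) {σ : X → Val d}
    (hσm : Measurable σ) {l : Measure X} [IsFiniteMeasure l] (hσ : Integrable σ l) {S : ℝ}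
    (hS : ∀ Y : C(X, Val d), (∀ x, Y x ∈ B x) → ∫ x, pair (Y x) (σ x) ∂l ≤ S)
    {g : X → ℝ≥0∞} (hg : ∀ x (a : ℝ), 0 ≤ a → ENNReal.ofReal a < g x →
      ∃ y ∈ interior (B x), a < pair y (σ x)) :
    ∫⁻ x, g x ∂l ≤ ENNReal.ofReal S := by
  have hlim := isSelectionLimit_selectionMax hB hB0 hBo hσm hσ
  have hle : ∀ n, ∫⁻ x, ENNReal.ofReal (selectionMax B σ n x) ∂l ≤ ENNReal.ofReal S := fun n => by
    refine ENNReal.le_of_forall_pos_le_add fun ε hε _ => ?_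
    obtain ⟨Y, hYB, hY⟩ := (hlim n).2 ε (by simpa using hε.ne')
    have hYi := integrable_pair l hσ Y
    have hdi : Integrable (fun x => selectionMax B σ n x - pair (Y x) (σ x)) l :=
      ⟨(hlim n).1.aestronglyMeasurable.sub hYi.1, hY.trans_lt ENNReal.coe_lt_top⟩
    have hi : Integrable (selectionMax B σ n) l := by
      refine (hdi.add hYi).congr (ae_of_all _ fun x => ?_)
      simp
    have hd : ∫ x, (selectionMax B σ n x - pair (Y x) (σ x)) ∂l ≤ ε := by
      refine (le_abs_self _).trans ?_
      have := (enorm_integral_le_lintegral_enorm _).trans hY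
      rwa [← Real.norm_eq_abs, ← coe_nnnorm, NNReal.coe_le_coe, ← ENNReal.coe_le_coe]
    rw [← ofReal_integral_eq_lintegral_ofReal hi (ae_of_all _ (selectionMax_nonneg B σ n)),
      ← ENNReal.ofReal_coe_nnreal]
    refine (ENNReal.ofReal_le_ofReal ?_).trans ENNReal.ofReal_add_le
    rw [integral_sub hi hYi] at hd
    linarith [hS Y hYB]
  calc ∫⁻ x, g x ∂l ≤ ∫⁻ x, ⨆ n, ENNReal.ofReal (selectionMax B σ n x) ∂l := by
        refine lintegral_mono fun x => le_of_forall_lt fun c hc => ?_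
        have hc' : ENNReal.ofReal c.toReal = c := ENNReal.ofReal_toReal hc.ne_top
        obtain ⟨n, hn⟩ := exists_lt_selectionMax
          (hg x c.toReal ENNReal.toReal_nonneg (by rwa [hc']))
        refine lt_iSup_iff.2 ⟨n, ?_⟩
        rw [← hc']
        exact (ENNReal.ofReal_lt_ofReal_iff (ENNReal.toReal_nonneg.trans_lt hn)).2 hn
    _ = ⨆ n, ∫⁻ x, ENNReal.ofReal (selectionMax B σ n x) ∂l :=
        lintegral_iSup (fun n => (hlim n).1.ennreal_ofReal) fun m n hmn x =>
          ENNReal.ofReal_le_ofReal (monotone_selectionMax B σ x hmn)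
    _ ≤ ENNReal.ofReal S := iSup_le hle

end Selection

/-! ### Triplets of measures as functionals on continuous fields -/

namespace MeasureTriple

/-- The integral `∫ ⟨Y, d(ρ, ω, ζ)⟩` of a field `Y` against a triplet of measures. -/
def integral (μ : MeasureTriple 0 1 Ω) (Y : Cyl 0 1 Ω → Val d) : ℝ :=
  (∫ᵛ p, (Y p).1 ∂<•μ.ρ) + ∑ i, (∫ᵛ p, (Y p).2.1 i ∂<•(μ.ω i)) + (∫ᵛ p, (Y p).2.2 ∂<•μ.ζ)

lemma absCont_dominating (μ : MeasureTriple 0 1 Ω) : μ.AbsCont μ.dominating := by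
  refine ⟨?_, fun i => ?_, ?_⟩
  · refine Measure.absolutelyContinuous_of_le ?_
    rw [dominating, add_assoc]
    exact Measure.le_add_right le_rfl
  · refine Measure.absolutelyContinuous_of_le ?_
    rw [dominating]
    refine Measure.le_add_right (Measure.le_add_left ?_)
    exact Finset.single_le_sum (f := fun i => (μ.ω i).totalVariation)
      (fun _ _ => Measure.zero_le _) (Finset.mem_univ i)
  · refine Measure.absolutelyContinuous_of_le ?_
    rw [dominating]
    exact Measure.le_add_left le_rfl

lemma measurable_density (μ : MeasureTriple 0 1 Ω) (l : Measure (Cyl 0 1 Ω)) :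
    Measurable (μ.density l) := by
  refine (SignedMeasure.measurable_rnDeriv _ _).prodMk (Measurable.prodMk ?_
    (SignedMeasure.measurable_rnDeriv _ _))
  exact (WithLp.measurable_toLp 2 _).comp
    (measurable_pi_lambda _ fun i => SignedMeasure.measurable_rnDeriv _ _)

lemma integrable_density (μ : MeasureTriple 0 1 Ω) (l : Measure (Cyl 0 1 Ω)) :
    Integrable (μ.density l) l := by
  refine Integrable.prodMk (SignedMeasure.integrable_rnDeriv _ _) (Integrable.prodMk ?_
    (SignedMeasure.integrable_rnDeriv _ _))
  rw [← memLp_one_iff_integrable]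
  refine (EuclideanSpace.equiv (Fin d) ℝ).symm.toContinuousLinearMap.comp_memLp' ?_
  rw [memLp_pi_iff]
  exact fun i => memLp_one_iff_integrable.2 (SignedMeasure.integrable_rnDeriv _ _)

lemma integral_pair_density [CompactSpace Ω] (μ : MeasureTriple 0 1 Ω)
    {l : Measure (Cyl 0 1 Ω)} [IsFiniteMeasure l] (hl : μ.AbsCont l)
    (Y : C(Cyl 0 1 Ω, Val d)) :
    ∫ p, pair (Y p) (μ.density l p) ∂l = μ.integral Y := by
  have hY1 : Continuous fun p => (Y p).1 := by fun_prop
  have hY2 : ∀ i, Continuous fun p => (Y p).2.1 i := fun i => by fun_prop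
  have hY3 : Continuous fun p => (Y p).2.2 := by fun_prop
  have hb1 : ∀ p, ‖(Y p).1‖ ≤ ‖Y‖ := fun p => (norm_fst_le _).trans (Y.norm_coe_le_norm p)
  have hb : ∀ p, ‖(Y p).2‖ ≤ ‖Y‖ := fun p => (norm_snd_le _).trans (Y.norm_coe_le_norm p)
  have hb2 : ∀ i p, ‖(Y p).2.1 i‖ ≤ ‖Y‖ := fun i p =>
    (PiLp.norm_apply_le _ i).trans ((norm_fst_le _).trans (hb p))
  have hb3 : ∀ p, ‖(Y p).2.2‖ ≤ ‖Y‖ := fun p => (norm_snd_le _).trans (hb p)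
  have hi : ∀ (s : SignedMeasure (Cyl 0 1 Ω)) {g : Cyl 0 1 Ω → ℝ}, Continuous g →
      (∀ p, ‖g p‖ ≤ ‖Y‖) → Integrable (fun p => g p * s.rnDeriv l p) l := fun s g hg hgb =>
    (SignedMeasure.integrable_rnDeriv s l).bdd_mul hg.aestronglyMeasurable (ae_of_all _ hgb)
  have hi2 : Integrable (fun p => ∑ i, (Y p).2.1 i * (μ.ω i).rnDeriv l p) l :=
    integrable_finsetSum _ fun i _ => hi (μ.ω i) (hY2 i) (hb2 i)
  rw [integral,
    vectorIntegral_eq_integral_mul_rnDeriv μ.ρ l hl.1 hY1.measurable hb1,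
    vectorIntegral_eq_integral_mul_rnDeriv μ.ζ l hl.2.2 hY3.measurable hb3,
    Finset.sum_congr rfl fun i _ => vectorIntegral_eq_integral_mul_rnDeriv (μ.ω i) l (hl.2.1 i)
      (hY2 i).measurable (hb2 i),
    ← integral_finsetSum _ fun i _ => hi (μ.ω i) (hY2 i) (hb2 i),
    ← integral_add (hi _ hY1 hb1) hi2, ← integral_add ?_ (hi _ hY3 hb3)]
  rotate_left
  · exact (hi _ hY1 hb1).add hi2
  congr 1 with p
  simp [pair, density, PiLp.inner_apply, mul_comm]

/-- The Riesz representation theorem for fields with values in `ℝ × ℝ^d × ℝ`. -/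
lemma exists_integral_eq [CompactSpace Ω] (ℓ : C(Cyl 0 1 Ω, Val d) →L[ℝ] ℝ) :
    ∃ μ : MeasureTriple 0 1 Ω, ∀ Y : C(Cyl 0 1 Ω, Val d), ℓ Y = μ.integral Y := by
  have key : ∀ J : ℝ →L[ℝ] Val d, ∃ s : SignedMeasure (Cyl 0 1 Ω), ∀ g : C(Cyl 0 1 Ω, ℝ),
      ℓ (J.compLeftContinuous ℝ _ g) = ∫ᵛ p, g p ∂<•s := fun J => by
    obtain ⟨k, l, _, _, h⟩ := exists_measure_sub (ℓ.comp (J.compLeftContinuous ℝ _))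
    refine ⟨k.toSignedMeasure - l.toSignedMeasure, fun g => ?_⟩
    rw [vectorIntegral_sub_toSignedMeasure _ _ (g.continuous.integrable_of_hasCompactSupport
      (HasCompactSupport.of_compactSpace _)) (g.continuous.integrable_of_hasCompactSupport
      (HasCompactSupport.of_compactSpace _))]
    exact h g
  let J₂ : Fin d → ℝ →L[ℝ] Val d := fun i =>
    (ContinuousLinearMap.inr ℝ ℝ (Space d × ℝ)).comp ((ContinuousLinearMap.inl ℝ (Space d) ℝ).comp
      (ContinuousLinearMap.toSpanSingleton ℝ (EuclideanSpace.single i (1 : ℝ))))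
  obtain ⟨ρ, hρ⟩ := key (.inl ℝ ℝ (Space d × ℝ))
  obtain ⟨ζ, hζ⟩ := key ((ContinuousLinearMap.inr ℝ ℝ (Space d × ℝ)).comp (.inr ℝ (Space d) ℝ))
  choose ω hω using fun i => key (J₂ i)
  refine ⟨⟨ρ, ω, ζ⟩, fun Y => ?_⟩
  have h1 := hρ ⟨fun p => (Y p).1, by fun_prop⟩
  have h2 := fun i => hω i ⟨fun p => (Y p).2.1 i, by fun_prop⟩
  have h3 := hζ ⟨fun p => (Y p).2.2, by fun_prop⟩
  simp only [ContinuousMap.coe_mk] at h1 h2 h3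
  rw [integral, ← h1, ← h3, Finset.sum_congr rfl fun i _ => (h2 i).symm, ← map_sum, ← map_add,
    ← map_add]
  congr 1
  ext p : 1
  rw [ContinuousMap.add_apply, ContinuousMap.add_apply, ContinuousMap.sum_apply]
  change Y p = ((Y p).1, 0, 0) +
    ∑ i, ((0, (Y p).2.1 i • EuclideanSpace.single i (1 : ℝ), 0) : Val d) + (0, 0, (Y p).2.2)
  have hsum : ∑ i, ((0, (Y p).2.1 i • EuclideanSpace.single i (1 : ℝ), 0) : Val d) =
      (0, (Y p).2.1, 0) := by
    refine Prod.ext ?_ (Prod.ext ?_ ?_)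
    · simp [Prod.fst_sum]
    · ext j
      simp [Prod.fst_sum, Prod.snd_sum, Pi.single_apply]
    · simp [Prod.snd_sum]
  rw [hsum]
  simp

end MeasureTriple

/-! ### The fields `(∂ₜφ, ∇φ, φ)` -/

lemma timeDeriv_eq_fderiv {φ : ℝ × Space d → ℝ} (hφ : ContDiff ℝ 1 φ) (t : ℝ) (x : Space d) :
    timeDeriv φ t x = fderiv ℝ φ (t, x) (1, 0) := by
  have h := (hφ.differentiable one_ne_zero (t, x)).hasFDerivAt
  exact (h.comp_hasDerivAt t ((hasDerivAt_id t).prodMk (hasDerivAt_const t x))).deriv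

lemma spaceGrad_eq_fderiv {φ : ℝ × Space d → ℝ} (hφ : ContDiff ℝ 1 φ) (t : ℝ) (x : Space d) :
    spaceGrad φ t x = (InnerProductSpace.toDual ℝ (Space d)).symm
      ((fderiv ℝ φ (t, x)).comp (.inr ℝ ℝ (Space d))) := by
  have h := (hφ.differentiable one_ne_zero (t, x)).hasFDerivAt
  rw [spaceGrad, gradient]
  congr 1
  exact (h.comp x (hasFDerivAt_prodMk_right t x)).fderiv

/-- The field `(∂ₜφ, ∇φ, φ)` on `[0, 1] × Ω` defined by a test function `φ`. -/
def testField (Ω : Set (Space d)) {φ : ℝ × Space d → ℝ} (hφ : ContDiff ℝ 1 φ) :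
    C(Cyl 0 1 Ω, Val d) where
  toFun p := (timeDeriv φ p.1 p.2, spaceGrad φ p.1 p.2, φ (p.1, p.2))
  continuous_toFun := by
    have h1 := hφ.continuous_fderiv one_ne_zero
    have h2 := hφ.continuous
    have h3 : Continuous fun p : Cyl 0 1 Ω => ((p.1 : ℝ), (p.2 : Space d)) := by fun_prop
    have h4 := h1.comp h3
    simp only [timeDeriv_eq_fderiv hφ, spaceGrad_eq_fderiv hφ]
    refine Continuous.prodMk ?_ (Continuous.prodMk ?_ ?_)
    · exact h4.clm_apply continuous_const
    · exact (LinearIsometryEquiv.continuous _).comp (h4.clm_comp continuous_const)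
    · exact h2.comp h3

/-- The space of all fields `(∂ₜφ, ∇φ, φ)`. -/
def testFields (Ω : Set (Space d)) : Submodule ℝ C(Cyl 0 1 Ω, Val d) where
  carrier := {Y | ∃ (φ : ℝ × Space d → ℝ) (hφ : ContDiff ℝ 1 φ), testField Ω hφ = Y}
  zero_mem' := ⟨fun _ => 0, contDiff_const, by
    ext p : 1
    simp [testField, timeDeriv, spaceGrad, gradient]⟩
  add_mem' := by
    rintro _ _ ⟨φ, hφ, rfl⟩ ⟨ψ, hψ, rfl⟩
    refine ⟨fun q => φ q + ψ q, hφ.add hψ, ?_⟩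
    ext p : 1
    have h : ∀ q, fderiv ℝ (fun q => φ q + ψ q) q = fderiv ℝ φ q + fderiv ℝ ψ q := fun q =>
      fderiv_fun_add (hφ.differentiable one_ne_zero q) (hψ.differentiable one_ne_zero q)
    simp [testField, timeDeriv_eq_fderiv, spaceGrad_eq_fderiv, hφ, hψ, hφ.add hψ, h,
      ContinuousLinearMap.add_comp]
  smul_mem' := by
    rintro c _ ⟨φ, hφ, rfl⟩
    refine ⟨fun q => c * φ q, contDiff_const.mul hφ, ?_⟩
    ext p : 1
    have h : ∀ q, fderiv ℝ (fun q => c * φ q) q = c • fderiv ℝ φ q := fun q =>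
      fderiv_const_mul (hφ.differentiable one_ne_zero q) c
    simp [testField, timeDeriv_eq_fderiv, spaceGrad_eq_fderiv, hφ, contDiff_const.mul hφ, h,
      ContinuousLinearMap.smul_comp]

/-- The functional `(α, β, φ) ↦ ∫ φ(1, ·) dρ₁ - ∫ φ(0, ·) dρ₀` on continuous fields. -/
def boundaryFunctional [CompactSpace Ω] (ρ₀ ρ₁ : Measure Ω) [IsFiniteMeasure ρ₀]
    [IsFiniteMeasure ρ₁] : C(Cyl 0 1 Ω, Val d) →ₗ[ℝ] ℝ :=
  have hi : ∀ (k : Measure Ω) [IsFiniteMeasure k] (Y : C(Cyl 0 1 Ω, Val d)) (t : Icc (0 : ℝ) 1),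
      Integrable (fun x => (Y (t, x)).2.2) k := fun k _ Y t =>
    Continuous.integrable_of_hasCompactSupport (by fun_prop) (HasCompactSupport.of_compactSpace _)
  { toFun := fun Y => ∫ x, (Y (1, x)).2.2 ∂ρ₁ - ∫ x, (Y (0, x)).2.2 ∂ρ₀
    map_add' := fun Y Z => by
      simp only [ContinuousMap.add_apply, Prod.snd_add]
      rw [integral_add (hi _ _ _) (hi _ _ _), integral_add (hi _ _ _) (hi _ _ _)]
      ring
    map_smul' := fun c Y => by
      simp only [ContinuousMap.smul_apply, Prod.smul_snd, smul_eq_mul, integral_const_mul,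
        RingHom.id_apply]
      ring }

lemma boundaryFunctional_testField [CompactSpace Ω] (ρ₀ ρ₁ : Measure Ω) [IsFiniteMeasure ρ₀]
    [IsFiniteMeasure ρ₁] {φ : ℝ × Space d → ℝ} (hφ : ContDiff ℝ 1 φ) :
    boundaryFunctional ρ₀ ρ₁ (testField Ω hφ) =
      (∫ x : Ω, φ (1, x) ∂ρ₁) - ∫ x : Ω, φ (0, x) ∂ρ₀ :=
  rfl

lemma mem_continuityEq_iff {ρ₀ ρ₁ : Measure Ω} {μ : MeasureTriple 0 1 Ω} :
    μ ∈ ContinuityEq 0 1 Ω ρ₀ ρ₁ ↔ ∀ (φ : ℝ × Space d → ℝ) (hφ : ContDiff ℝ 1 φ),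
      μ.integral (testField Ω hφ) = (∫ x : Ω, φ (1, x) ∂ρ₁) - ∫ x : Ω, φ (0, x) ∂ρ₀ :=
  Iff.rfl

/-- The continuity equation is solved by the triplet `(0, 0, δ₁ ⊗ ρ₁ - δ₀ ⊗ ρ₀)`. -/
lemma continuityEq_nonempty [CompactSpace Ω] (ρ₀ ρ₁ : Measure Ω) [IsFiniteMeasure ρ₀]
    [IsFiniteMeasure ρ₁] : (ContinuityEq 0 1 Ω ρ₀ ρ₁).Nonempty := by
  have hm : ∀ t : Icc (0 : ℝ) 1, Measurable fun x : Ω => ((t, x) : Cyl 0 1 Ω) := fun t => by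
    fun_prop
  refine ⟨⟨0, 0, (ρ₁.map fun x => (1, x)).toSignedMeasure -
    (ρ₀.map fun x => (0, x)).toSignedMeasure⟩, fun φ hφ => ?_⟩
  have hc : Continuous fun p : Cyl 0 1 Ω => φ (p.1, p.2) := hφ.continuous.comp (by fun_prop)
  have hi : ∀ (k : Measure (Cyl 0 1 Ω)) [IsFiniteMeasure k],
      Integrable (fun p : Cyl 0 1 Ω => φ (p.1, p.2)) k := fun k _ =>
    hc.integrable_of_hasCompactSupport (HasCompactSupport.of_compactSpace _)
  rw [vectorIntegral_sub_toSignedMeasure _ _ (hi _) (hi _),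
    integral_map (hm 1).aemeasurable hc.aestronglyMeasurable,
    integral_map (hm 0).aemeasurable hc.aestronglyMeasurable]
  simp

/-! ### Duality -/

lemma mem_dualFeasible_iff {f : Ω → Val d → ℝ≥0∞} {φ : ℝ × Space d → ℝ}
    (hφ : ContDiff ℝ 1 φ) :
    φ ∈ dualFeasible f ↔ ∀ p, testField Ω hφ p ∈ polarSet (f p.2) :=
  ⟨fun h p => h.2 p.1 p.1.2 p.2, fun h => ⟨hφ, fun t ht x => h (⟨t, ht⟩, x)⟩⟩

lemma integral_le_action [CompactSpace Ω] {f : Ω → Val d → ℝ≥0∞} (μ : MeasureTriple 0 1 Ω)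
    {Y : C(Cyl 0 1 Ω, Val d)} (hY : ∀ p, Y p ∈ polarSet (f p.2)) :
    ((μ.integral Y : ℝ) : EReal) ≤ (action f μ : EReal) := by
  suffices h : ENNReal.ofReal (μ.integral Y) ≤ action f μ by
    refine le_trans ?_ (EReal.coe_ennreal_le_coe_ennreal_iff.2 h)
    rw [EReal.coe_ennreal_ofReal]
    exact EReal.coe_le_coe_iff.2 (le_max_left _ _)
  rw [← μ.integral_pair_density μ.absCont_dominating Y]
  rw [integral_eq_lintegral_pos_part_sub_lintegral_neg_part
    (integrable_pair _ (μ.integrable_density _) Y)]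
  refine (ENNReal.ofReal_le_ofReal (sub_le_self _ ENNReal.toReal_nonneg)).trans ?_
  refine ENNReal.ofReal_toReal_le.trans ?_
  exact lintegral_mono fun p => mem_polarSet_iff.1 (hY p) _

/-- The action is the supremum of the integrals of continuous fields with values in the polar
sets. -/
lemma action_le_of_forall_integral_le [CompactSpace Ω] {f : Ω → Val d → ℝ≥0∞}
    (hf : IsInfinitesimalCost f) (hB : IsLSCMultifunction (fun x : Ω => polarSet (f x)))
    (μ : MeasureTriple 0 1 Ω) {S : ℝ}
    (hS : ∀ Y : C(Cyl 0 1 Ω, Val d), (∀ p, Y p ∈ polarSet (f p.2)) → μ.integral Y ≤ S) :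
    action f μ ≤ ENNReal.ofReal S := by
  refine lintegral_le_of_forall_selection (B := fun p : Cyl 0 1 Ω => polarSet (f p.2))
    (σ := μ.density μ.dominating) (fun p => convex_polarSet _) (fun p => zero_mem_polarSet _) ?_
    (μ.measurable_density _) (μ.integrable_density _) (fun Y hY => ?_)
    (fun p a ha h => hf.exists_mem_interior_lt_pair p.2 ha h)
  · exact hB.preimage (f := fun q : Cyl 0 1 Ω × Val d => (q.1.2, q.2)) (by fun_prop)
  · rw [μ.integral_pair_density μ.absCont_dominating]
    exact hS Y hY

/-- The test function `-ε t` defines a field in the interior of the constraint set of the dual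
problem. -/
lemma exists_testField_ball_subset [CompactSpace Ω] {f : Ω → Val d → ℝ≥0∞} {ε : ℝ} (hε : 0 < ε)
    (h : ∀ x, IsInfinitesimalCost.box d ε ⊆ polarSet (f x)) :
    ∃ Y₀ ∈ testFields Ω, Metric.ball Y₀ (ε / 4) ⊆
      {Y : C(Cyl 0 1 Ω, Val d) | ∀ p, Y p ∈ polarSet (f p.2)} := by
  have hφ : ContDiff ℝ 1 fun q : ℝ × Space d => -ε * q.1 := by fun_prop
  refine ⟨testField Ω hφ, ⟨_, hφ, rfl⟩, fun Y hY p => h _ ?_⟩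
  have hval : testField Ω hφ p = (-ε, 0, -ε * p.1) := by
    have h1 : timeDeriv (fun q : ℝ × Space d => -ε * q.1) p.1 p.2 = -ε := by
      rw [timeDeriv, deriv_const_mul_field, deriv_id'']
      simp
    have h2 : spaceGrad (fun q : ℝ × Space d => -ε * q.1) p.1 p.2 = 0 := by
      simp [spaceGrad, gradient]
    exact Prod.ext h1 (Prod.ext h2 rfl)
  have hd : ‖Y p - (-ε, 0, -ε * p.1)‖ < ε / 4 := by
    rw [← hval, ← dist_eq_norm]
    exact (ContinuousMap.dist_apply_le_dist p).trans_lt hY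
  have h1 := (norm_fst_le _).trans hd.le
  have h2 := (norm_fst_le _).trans ((norm_snd_le _).trans hd.le)
  have h3 := (norm_snd_le _).trans ((norm_snd_le _).trans hd.le)
  simp only [Prod.fst_sub, Prod.snd_sub, sub_neg_eq_add, sub_zero, Real.norm_eq_abs, neg_mul]
    at h1 h2 h3
  refine IsInfinitesimalCost.mem_box.2 ⟨h1, h2, ?_⟩
  obtain ⟨hp0, hp1⟩ := p.1.2
  rw [abs_le] at h3 ⊢
  constructor <;> nlinarith

/-- If the dual problem has a finite value, the primal problem has a solution whose action is at
most this value: extend the boundary functional from the test fields to all continuous fields,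
and represent the extension by measures. -/
lemma exists_action_le (hΩ : IsCompact Ω) {f : Ω → Val d → ℝ≥0∞} (hf : IsInfinitesimalCost f)
    (hB : IsLSCMultifunction (fun x : Ω => polarSet (f x)))
    (ρ₀ ρ₁ : Measure Ω) [IsFiniteMeasure ρ₀] [IsFiniteMeasure ρ₁] {S : ℝ}
    (hS : ∀ φ ∈ dualFeasible f, (∫ x : Ω, φ (1, x) ∂ρ₁) - (∫ x : Ω, φ (0, x) ∂ρ₀) ≤ S) :
    ∃ μ ∈ ContinuityEq 0 1 Ω ρ₀ ρ₁, action f μ ≤ ENNReal.ofReal S := by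
  have : CompactSpace Ω := isCompact_iff_compactSpace.1 hΩ
  obtain ⟨ε, hε, hbox⟩ := hf.exists_box_subset_polarSet hΩ hB
  obtain ⟨Y₀, hY₀, hball⟩ := exists_testField_ball_subset hε hbox
  have hconv : Convex ℝ {Y : C(Cyl 0 1 Ω, Val d) | ∀ p, Y p ∈ polarSet (f p.2)} :=
    fun Y hY Z hZ a b ha hb hab p => convex_polarSet _ (hY p) (hZ p) ha hb hab
  obtain ⟨ℓ, hℓ, hℓS⟩ := exists_extension_le_of_convex (boundaryFunctional ρ₀ ρ₁) hconv hY₀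
    (by positivity) hball (S := S) (by
      rintro _ ⟨φ, hφ, rfl⟩ h
      rw [boundaryFunctional_testField]
      exact hS φ ((mem_dualFeasible_iff hφ).2 h))
  obtain ⟨μ, hμ⟩ := MeasureTriple.exists_integral_eq ℓ
  refine ⟨μ, mem_continuityEq_iff.2 fun φ hφ => ?_,
    action_le_of_forall_integral_le hf hB μ fun Y hY => ?_⟩
  · rw [← hμ, hℓ _ ⟨φ, hφ, rfl⟩, boundaryFunctional_testField]
  · rw [← hμ]
    exact hℓS Y hY

end DynamicOT

end

theorem mainTheorem8 (d : ℕ) (Ω : Set (Space d)) (hΩ : IsCompact Ω)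
    (f : Ω → Val d → ℝ≥0∞) (hf : IsInfinitesimalCost f)
    (hB : IsLSCMultifunction (fun x : Ω => polarSet (f x)))
    (ρ₀ ρ₁ : Measure Ω) [IsFiniteMeasure ρ₀] [IsFiniteMeasure ρ₁] :
    (∃ μ ∈ ContinuityEq 0 1 Ω ρ₀ ρ₁, action f μ = dynamicCost f ρ₀ ρ₁) ∧
      ((dynamicCost f ρ₀ ρ₁ : ℝ≥0∞) : EReal) =
        ⨆ φ ∈ dualFeasible f,
          (((∫ x : Ω, φ (1, x) ∂ρ₁) - (∫ x : Ω, φ (0, x) ∂ρ₀) : ℝ) : EReal) := by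
  have : CompactSpace Ω := isCompact_iff_compactSpace.1 hΩ
  set s : EReal := ⨆ φ ∈ dualFeasible f,
    (((∫ x : Ω, φ (1, x) ∂ρ₁) - (∫ x : Ω, φ (0, x) ∂ρ₀) : ℝ) : EReal) with hs
  have hs0 : 0 ≤ s := by
    have h0 : (fun _ => 0 : ℝ × Space d → ℝ) ∈ dualFeasible f :=
      (mem_dualFeasible_iff contDiff_const).2 fun p => by
        rw [show testField Ω contDiff_const p = (0 : Val d) by
          simp [testField, timeDeriv, spaceGrad, gradient]]
        exact zero_mem_polarSet _
    refine le_trans ?_ (le_iSup₂ _ h0)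
    simp
  have hweak : ∀ μ ∈ ContinuityEq 0 1 Ω ρ₀ ρ₁, s ≤ (action f μ : EReal) := fun μ hμ =>
    iSup₂_le fun φ hφ => by
      rw [← mem_continuityEq_iff.1 hμ φ hφ.1]
      exact integral_le_action μ ((mem_dualFeasible_iff hφ.1).1 hφ)
  have hexists : ∃ μ ∈ ContinuityEq 0 1 Ω ρ₀ ρ₁, (action f μ : EReal) ≤ s := by
    rcases eq_or_ne s ⊤ with h | h
    · obtain ⟨μ, hμ⟩ := continuityEq_nonempty ρ₀ ρ₁
      exact ⟨μ, hμ, h ▸ le_top⟩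
    lift s to ℝ using ⟨h, (EReal.bot_lt_zero.trans_le hs0).ne'⟩ with S
    obtain ⟨μ, hμ, hle⟩ := exists_action_le hΩ hf hB ρ₀ ρ₁ (S := S) fun φ hφ => by
      rw [← EReal.coe_le_coe_iff, hs]
      exact le_iSup₂ (f := fun (φ : ℝ × Space d → ℝ) (_ : φ ∈ dualFeasible f) =>
        (((∫ x : Ω, φ (1, x) ∂ρ₁) - (∫ x : Ω, φ (0, x) ∂ρ₀) : ℝ) : EReal)) φ hφ
    refine ⟨μ, hμ, (EReal.coe_ennreal_le_coe_ennreal_iff.2 hle).trans ?_⟩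
    rw [EReal.coe_ennreal_ofReal, max_eq_left (EReal.coe_nonneg.1 hs0)]
  obtain ⟨μ, hμ, hle⟩ := hexists
  have hmin : action f μ = dynamicCost f ρ₀ ρ₁ :=
    le_antisymm (le_iInf₂ fun ν hν =>
      EReal.coe_ennreal_le_coe_ennreal_iff.1 (hle.trans (hweak ν hν))) (iInf₂_le μ hμ)
  exact ⟨⟨μ, hμ, hmin⟩, hmin ▸ le_antisymm hle (hweak μ hμ)⟩
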